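/- Let $\mathbb{K}=\mathbb{R}$ or $\mathbb{C}$, let $m\ge 2$ be an integer, let $2\le q<\infty$, and let $F$ be a Banach space over $\mathbb{K}$ of (Rademacher) cotype $q$. Then there is a constant $C$, depending only on $m$, $q$ and $F$, such that the following holds. Let $1\le r\le q$ and $p_1,\dots,p_m\in[1,\infty]$ (with $1/\infty=0$) satisfy $$\frac1{p_1}+\cdots+\frac1{p_m}<\frac1r\qquad\text{and}\qquad \sum_{k\ne i}\frac1{p_k}\le \frac1r-\frac1q\quad\text{for every } i\in\{1,\dots,m\},$$ and define $\lambda_r\in(0,\infty)$ by $\frac1{\lambda_r}=\frac1r-\left(\frac1{p_1}+\cdots+\frac1{p_m}\right)$. Let $E$ be a Banach space over $\mathbb{K}$ and let $v\colon E\to F$ be an absolutely $(r,1)$-summing operator, that is, a bounded linear operator for which there is $D\ge 0$ with $$\Big(\sum_{j=1}^N\|v(x_j)\|_F^r\Big)^{1/r}\le D\,\sup_{\varphi\in B_{E^*}}\sum_{j=1}^N|\varphi(x_j)|$$ for all finite families $x_1,\dots,x_N\in E$; let $\pi_{r,1}(v)$ be the infimum of all such $D$. Then for every positive integer $n$, every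 $m$-linear operator $A\colon \ell_{p_1}^n\times\cdots\times\ell_{p_m}^n\to E$ and every $i\in\{1,\dots,m\}$, $$\left(\sum_{j_i=1}^n\left(\sum_{\widehat{j_i}=1}^n\|vA(e_{j_1},\dots,e_{j_m})\|_F^q\right)^{\lambda_r/q}\right)^{1/\lambda_r}\le C\,\|A\|\,\pi_{r,1}(v),$$ where $\ell_p^n$ is $\mathbb{K}^n$ with the $\ell_p$ norm, $(e_j)$ is its canonical basis, $\|A\|$ is the supremum of $\|A(z^{(1)},\dots,z^{(m)})\|_E$ over the unit balls of the $\ell_{p_k}^n$, and $\sum_{\widehat{j_i}=1}^n$ is the sum over all indices $j_k$, $k\neq i$, each from $1$ to $n$. -/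

import Mathlib

open scoped ENNReal

/-- `F` has (Rademacher) cotype `q`: there is a constant `K` such that, for all finite families
`x₁, …, x_N` in `F`, `(∑ ‖x_j‖ ^ q) ^ (1 / q)` is at most `K` times the quadratic mean of
`‖∑ ε_j x_j‖` over all `2 ^ N` choices of signs. As usual, only `2 ≤ q < ∞` is of interest. -/
def HasCotype (F : Type*) [NormedAddCommGroup F] (q : ℝ) : Prop :=
  ∃ K : ℝ, 0 ≤ K ∧ ∀ (N : ℕ) (x : Fin N → F),
    (∑ j, ‖x j‖ ^ q) ^ (1 / q) ≤
      K * Real.sqrt ((∑ ε : Fin N → ℤˣ, ‖∑ j, (ε j : ℤ) • x j‖ ^ 2) / 2 ^ N)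

/-- The weak `ℓ₁` norm `sup_{‖φ‖ ≤ 1} ∑ |φ(x_j)|` of a finite family in `E`,
the supremum being taken over the closed unit ball of the dual. -/
noncomputable def weakL1Norm (𝕜 : Type*) [RCLike 𝕜] {E : Type*} [NormedAddCommGroup E]
    [NormedSpace 𝕜 E] {N : ℕ} (x : Fin N → E) : ℝ :=
  ⨆ φ : Metric.closedBall (0 : StrongDual 𝕜 E) 1, ∑ j, ‖(φ : StrongDual 𝕜 E) (x j)‖

/-- The set of all constants `C ≥ 0` that are admissible in the definition of an absolutely
`(r, 1)`-summing operator. -/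
def summingConstants {𝕜 : Type*} [RCLike 𝕜] {E F : Type*} [NormedAddCommGroup E]
    [NormedSpace 𝕜 E] [NormedAddCommGroup F] [NormedSpace 𝕜 F] (r : ℝ) (v : E →L[𝕜] F) : Set ℝ :=
  {C : ℝ | 0 ≤ C ∧ ∀ (N : ℕ) (x : Fin N → E),
    (∑ j, ‖v (x j)‖ ^ r) ^ (1 / r) ≤ C * weakL1Norm 𝕜 x}

/-- `v` is absolutely `(r, 1)`-summing. -/
def IsAbsolutelySumming {𝕜 : Type*} [RCLike 𝕜] {E F : Type*} [NormedAddCommGroup E]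
    [NormedSpace 𝕜 E] [NormedAddCommGroup F] [NormedSpace 𝕜 F] (r : ℝ) (v : E →L[𝕜] F) : Prop :=
  (summingConstants r v).Nonempty

/-- The `(r, 1)`-summing norm `π_{r,1}(v)`: the infimum of the admissible constants. -/
noncomputable def summingNorm {𝕜 : Type*} [RCLike 𝕜] {E F : Type*} [NormedAddCommGroup E]
    [NormedSpace 𝕜 E] [NormedAddCommGroup F] [NormedSpace 𝕜 F] (r : ℝ) (v : E →L[𝕜] F) : ℝ :=
  sInf (summingConstants r v)

/-- The space `ℓ_p^n`. -/
abbrev ellp (𝕜 : Type*) (p : ℝ≥0∞) (n : ℕ) : Type _ := PiLp p (fun _ : Fin n => 𝕜)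

/-- The canonical vector `e_j` of `ℓ_p^n`. -/
noncomputable def stdVec (𝕜 : Type*) [RCLike 𝕜] (p : ℝ≥0∞) (n : ℕ) (j : Fin n) : ellp 𝕜 p n :=
  PiLp.single p j (1 : 𝕜)

/-- The exponent `λ_r`, defined by `1 / λ_r = 1 / r - (1 / p₁ + ⋯ + 1 / p_m)` (with `1 / ∞ = 0`). -/
noncomputable def lambdaExp {m : ℕ} (p : Fin m → ℝ≥0∞) (r : ℝ) : ℝ :=
  (1 / r - ∑ k, ((p k)⁻¹).toReal)⁻¹

/-- The mixed sum
`(∑_{j_i} (∑_{j_k, k ≠ i} ‖a(j₁, …, j_m)‖ ^ q) ^ (l / q)) ^ (1 / l)`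
of an array `a`; the inner sum runs over all multi-indices whose `i`-th coordinate is `j_i`. -/
noncomputable def mixedSum {F : Type*} [NormedAddCommGroup F] {m n : ℕ}
    (a : (Fin m → Fin n) → F) (i : Fin m) (l q : ℝ) : ℝ :=
  (∑ t : Fin n, (∑ j : Fin m → Fin n with j i = t, ‖a j‖ ^ q) ^ (l / q)) ^ (1 / l)

open scoped BigOperators
open Finset

/-- Flip the sign of the `i`-th coordinate. -/
def flipSign {N : ℕ} (i : Fin N) (ε : Fin N → ℤˣ) : Fin N → ℤˣ :=
  Function.update ε i (-ε i)

/-- The Dirichlet energy of a function on the discrete cube. -/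
noncomputable def cubeEnergy {N : ℕ} (f : (Fin N → ℤˣ) → ℝ) : ℝ :=
  ∑ i, 𝔼 ε, (f ε - f (flipSign i ε)) ^ 2 / 4

/-- The variance of a function on the discrete cube. -/
noncomputable def cubeVariance {N : ℕ} (f : (Fin N → ℤˣ) → ℝ) : ℝ :=
  𝔼 ε, f ε ^ 2 - (𝔼 ε, f ε) ^ 2

theorem flipSign_involutive {N : ℕ} (i : Fin N) : Function.Involutive (flipSign i) := by
  intro ε
  simp [flipSign]

theorem flipSign_cons_zero {N : ℕ} (a : ℤˣ) (ε : Fin N → ℤˣ) :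
    flipSign 0 (Fin.cons a ε : Fin (N + 1) → ℤˣ) = (Fin.cons (-a) ε : Fin (N + 1) → ℤˣ) := by
  simp [flipSign, Fin.update_cons_zero]

theorem flipSign_cons_succ {N : ℕ} (i : Fin N) (a : ℤˣ) (ε : Fin N → ℤˣ) :
    flipSign i.succ (Fin.cons a ε : Fin (N + 1) → ℤˣ)
      = (Fin.cons a (flipSign i ε) : Fin (N + 1) → ℤˣ) := by
  simp [flipSign, Fin.cons_update]

theorem expect_consEquiv {α : Type*} [Fintype α] {N : ℕ} (f : (Fin (N + 1) → α) → ℝ) :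
    𝔼 ε, f ε = 𝔼 a, 𝔼 ε : Fin N → α, f (Fin.cons a ε : Fin (N + 1) → α) := by
  rw [← Fintype.expect_equiv (Fin.consEquiv fun _ : Fin (N + 1) => α)
    (fun x => f (Fin.cons x.1 x.2 : Fin (N + 1) → α)) f (fun _ => rfl), ← univ_product_univ,
    expect_product]

theorem expect_units (g : ℤˣ → ℝ) : 𝔼 a, g a = (g 1 + g (-1)) / 2 := by
  rw [Fintype.expect_eq_sum_div_card]
  simp [Fintype.card_units_int]

/-- Splitting the first variable: `f (a, ε) = g ε + a * h ε`. -/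
theorem exists_cube_split {N : ℕ} (f : (Fin (N + 1) → ℤˣ) → ℝ) :
    ∃ g h : (Fin N → ℤˣ) → ℝ, ∀ ε,
      f (Fin.cons 1 ε : Fin (N + 1) → ℤˣ) = g ε + h ε ∧
      f (Fin.cons (-1) ε : Fin (N + 1) → ℤˣ) = g ε - h ε :=
  ⟨fun ε => (f (Fin.cons 1 ε : Fin (N + 1) → ℤˣ) + f (Fin.cons (-1) ε : Fin (N + 1) → ℤˣ)) / 2,
    fun ε => (f (Fin.cons 1 ε : Fin (N + 1) → ℤˣ) - f (Fin.cons (-1) ε : Fin (N + 1) → ℤˣ)) / 2,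
    fun ε => ⟨by ring, by ring⟩⟩

theorem cubeEnergy_split {N : ℕ} {f : (Fin (N + 1) → ℤˣ) → ℝ} {g h : (Fin N → ℤˣ) → ℝ}
    (hf : ∀ ε, f (Fin.cons 1 ε : Fin (N + 1) → ℤˣ) = g ε + h ε ∧
      f (Fin.cons (-1) ε : Fin (N + 1) → ℤˣ) = g ε - h ε) :
    cubeEnergy f = cubeEnergy g + cubeEnergy h + 𝔼 ε, h ε ^ 2 := by
  unfold cubeEnergy
  simp only [Fin.sum_univ_succ, expect_consEquiv (α := ℤˣ), expect_units, flipSign_cons_zero,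
    flipSign_cons_succ, neg_neg, (hf _).1, (hf _).2]
  rw [add_comm, ← sum_add_distrib]
  congr 1
  · refine sum_congr rfl fun i _ => ?_
    rw [← expect_add_distrib, ← expect_add_distrib, expect_div]
    exact expect_congr rfl fun ε _ => by ring
  · rw [← expect_add_distrib, expect_div]
    exact expect_congr rfl fun ε _ => by ring

theorem cubeVariance_split {N : ℕ} {f : (Fin (N + 1) → ℤˣ) → ℝ} {g h : (Fin N → ℤˣ) → ℝ}
    (hf : ∀ ε, f (Fin.cons 1 ε : Fin (N + 1) → ℤˣ) = g ε + h ε ∧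
      f (Fin.cons (-1) ε : Fin (N + 1) → ℤˣ) = g ε - h ε) :
    cubeVariance f = cubeVariance g + 𝔼 ε, h ε ^ 2 := by
  unfold cubeVariance
  simp only [expect_consEquiv (α := ℤˣ), expect_units, (hf _).1, (hf _).2]
  simp only [expect_add_distrib, expect_sub_distrib, add_sq, sub_sq]
  ring

theorem cubeCoeff_split {N : ℕ} {f : (Fin (N + 1) → ℤˣ) → ℝ} {g h : (Fin N → ℤˣ) → ℝ}
    (hf : ∀ ε, f (Fin.cons 1 ε : Fin (N + 1) → ℤˣ) = g ε + h ε ∧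
      f (Fin.cons (-1) ε : Fin (N + 1) → ℤˣ) = g ε - h ε) :
    ∑ i, (𝔼 ε, f ε * ((ε i : ℤ) : ℝ)) ^ 2
      = ∑ i, (𝔼 ε, g ε * ((ε i : ℤ) : ℝ)) ^ 2 + (𝔼 ε, h ε) ^ 2 := by
  simp only [Fin.sum_univ_succ, expect_consEquiv (α := ℤˣ), expect_units, Fin.cons_zero,
    Fin.cons_succ, (hf _).1, (hf _).2]
  rw [add_comm]
  congr 1
  · refine sum_congr rfl fun i _ => ?_
    rw [← expect_add_distrib, expect_div]
    exact congrArg (· ^ 2) (expect_congr rfl fun ε _ => by ring)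
  · rw [← expect_add_distrib, expect_div]
    exact congrArg (· ^ 2) (expect_congr rfl fun ε _ => by push_cast; ring)

/-- Poincaré inequality on the discrete cube. -/
theorem cubeVariance_le_cubeEnergy {N : ℕ} (f : (Fin N → ℤˣ) → ℝ) :
    cubeVariance f ≤ cubeEnergy f := by
  induction N with
  | zero => simp [cubeVariance, cubeEnergy]
  | succ N ih =>
    obtain ⟨g, h, hf⟩ := exists_cube_split f
    rw [cubeVariance_split hf, cubeEnergy_split hf]
    have h1 := ih g
    have h2 : 0 ≤ cubeEnergy h :=
      sum_nonneg fun i _ => expect_nonneg fun ε _ => by positivity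
    linarith

/-- Improved Poincaré inequality: the constant doubles after removing the first level. -/
theorem two_mul_cubeVariance_le {N : ℕ} (f : (Fin N → ℤˣ) → ℝ) :
    2 * cubeVariance f ≤ cubeEnergy f + ∑ i, (𝔼 ε, f ε * ((ε i : ℤ) : ℝ)) ^ 2 := by
  induction N with
  | zero => simp [cubeVariance, cubeEnergy]
  | succ N ih =>
    obtain ⟨g, h, hf⟩ := exists_cube_split f
    rw [cubeVariance_split hf, cubeEnergy_split hf, cubeCoeff_split hf]
    have h1 := ih g
    have h2 := cubeVariance_le_cubeEnergy h
    have h3 : cubeVariance h = 𝔼 ε, h ε ^ 2 - (𝔼 ε, h ε) ^ 2 := rfl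
    linarith

theorem cubeEnergy_eq {N : ℕ} (f : (Fin N → ℤˣ) → ℝ) :
    cubeEnergy f = 𝔼 ε, f ε * (∑ i, (f ε - f (flipSign i ε))) / 2 := by
  simp only [mul_sum, sum_div, expect_sum_comm, cubeEnergy]
  refine sum_congr rfl fun i _ => ?_
  have h1 : 𝔼 ε, f (flipSign i ε) ^ 2 = 𝔼 ε, f ε ^ 2 :=
    Fintype.expect_equiv (flipSign_involutive i).toPerm _ _ fun _ => rfl
  have h2 : 𝔼 ε, (f ε - f (flipSign i ε)) ^ 2 / 4
      = (𝔼 ε, f ε ^ 2) / 4 + (𝔼 ε, f (flipSign i ε) ^ 2) / 4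
        - 𝔼 ε, f ε * f (flipSign i ε) / 2 := by
    rw [expect_div, expect_div, ← expect_add_distrib, ← expect_sub_distrib]
    exact expect_congr rfl fun ε _ => by ring
  have h3 : 𝔼 ε, f ε * (f ε - f (flipSign i ε)) / 2
      = (𝔼 ε, f ε ^ 2) / 2 - 𝔼 ε, f ε * f (flipSign i ε) / 2 := by
    rw [expect_div, ← expect_sub_distrib]
    exact expect_congr rfl fun ε _ => by ring
  rw [h2, h3, h1]
  ring

/-- **Kahane's inequality** (in the form of Latała and Oleszkiewicz): the quadratic mean of a
Rademacher sum is at most `√2` times its mean. -/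
theorem kahane_inequality {F : Type*} [NormedAddCommGroup F] [NormedSpace ℝ F] {N : ℕ}
    (x : Fin N → F) :
    𝔼 ε : Fin N → ℤˣ, ‖∑ j, (ε j : ℤ) • x j‖ ^ 2
      ≤ 2 * (𝔼 ε : Fin N → ℤˣ, ‖∑ j, (ε j : ℤ) • x j‖) ^ 2 := by
  set f : (Fin N → ℤˣ) → ℝ := fun ε => ‖∑ j, (ε j : ℤ) • x j‖ with hf
  have heven : ∀ ε, f (-ε) = f ε := fun ε => by simp [hf]
  have hcoef : ∀ i, 𝔼 ε, f ε * ((ε i : ℤ) : ℝ) = 0 := by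
    intro i
    have h1 : 𝔼 ε, f (-ε) * (((-ε) i : ℤ) : ℝ) = 𝔼 ε, f ε * ((ε i : ℤ) : ℝ) :=
      Fintype.expect_equiv (Equiv.neg _) _ _ fun _ => rfl
    have h2 : 𝔼 ε, f (-ε) * (((-ε) i : ℤ) : ℝ) = - 𝔼 ε, f ε * ((ε i : ℤ) : ℝ) := by
      rw [← expect_neg_distrib]
      exact expect_congr rfl fun ε _ => by rw [heven]; simp
    linarith
  have hflip : ∀ i ε, ∑ j, (flipSign i ε j : ℤ) • x j
      = ∑ j, (ε j : ℤ) • x j - (2 : ℝ) • ((ε i : ℤ) • x i) := by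
    intro i ε
    rw [← add_sum_erase _ _ (mem_univ i), ← add_sum_erase univ (fun j => (ε j : ℤ) • x j)
      (mem_univ i)]
    have : ∀ j ∈ univ.erase i, (flipSign i ε j : ℤ) • x j = (ε j : ℤ) • x j := by
      intro j hj
      simp [flipSign, Function.update_of_ne (ne_of_mem_erase hj)]
    rw [sum_congr rfl this]
    simp only [flipSign, Function.update_self, Units.val_neg, neg_smul, two_smul]
    abel
  have hlap : ∀ ε, ∑ i, (f ε - f (flipSign i ε)) ≤ 2 * f ε := by
    intro ε
    have h1 : ‖∑ i, ∑ j, (flipSign i ε j : ℤ) • x j‖ ≤ ∑ i, f (flipSign i ε) := norm_sum_le _ _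
    have h2 : ∑ i, ∑ j, (flipSign i ε j : ℤ) • x j
        = (N : ℝ) • (∑ j, (ε j : ℤ) • x j) - (2 : ℝ) • (∑ j, (ε j : ℤ) • x j) := by
      simp only [hflip, sum_sub_distrib, ← smul_sum, sum_const, card_univ, Fintype.card_fin,
        Nat.cast_smul_eq_nsmul]
    have h3 := norm_sub_norm_le ((N : ℝ) • (∑ j, (ε j : ℤ) • x j))
      ((2 : ℝ) • (∑ j, (ε j : ℤ) • x j))
    rw [← h2, norm_smul, norm_smul, Real.norm_natCast, Real.norm_ofNat] at h3
    rw [sum_sub_distrib, sum_const, card_univ, Fintype.card_fin, nsmul_eq_mul]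
    simp only [hf] at h1 ⊢
    linarith
  have hen : cubeEnergy f ≤ 𝔼 ε, f ε ^ 2 := by
    rw [cubeEnergy_eq]
    refine expect_le_expect fun ε _ => ?_
    have : f ε * ∑ i, (f ε - f (flipSign i ε)) ≤ f ε * (2 * f ε) :=
      mul_le_mul_of_nonneg_left (hlap ε) (norm_nonneg _)
    nlinarith
  have key := two_mul_cubeVariance_le f
  simp only [hcoef] at key
  have hv : cubeVariance f = 𝔼 ε, f ε ^ 2 - (𝔼 ε, f ε) ^ 2 := rfl
  simp only [ne_eq, OfNat.ofNat_ne_zero, not_false_eq_true, zero_pow, sum_const_zero,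
    add_zero] at key
  linarith

/-- Minkowski's inequality for averages. -/
theorem Lq_expect_le {ι α : Type*} [Fintype ι] [Fintype α] {q : ℝ} (hq : 1 ≤ q)
    (f : ι → α → ℝ) (hf : ∀ i a, 0 ≤ f i a) :
    (∑ i, (𝔼 a, f i a) ^ q) ^ (1 / q) ≤ 𝔼 a, (∑ i, f i a ^ q) ^ (1 / q) := by
  have hq0 : 0 < q := by linarith
  have h := le_expect_of_subadditive (s := (univ : Finset α)) (f := fun a i => f i a)
    (m := fun g : ι → ℝ => (∑ i, |g i| ^ q) ^ (1 / q))
    (by simp [Real.zero_rpow hq0.ne', hq0.ne'])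
    (fun a b => Real.Lp_add_le univ a b hq)
    (by
      intro n a
      have hn : (0 : ℝ) ≤ ((n : ℝ))⁻¹ := by positivity
      have h1 : ∀ i, |(((n : ℚ≥0))⁻¹ • a) i| ^ q = ((n : ℝ)⁻¹) ^ q * |a i| ^ q := by
        intro i
        rw [Pi.smul_apply, NNRat.smul_def, abs_mul]
        push_cast
        rw [abs_of_nonneg hn, Real.mul_rpow hn (abs_nonneg _)]
      simp only [h1, ← mul_sum]
      rw [Real.mul_rpow (by positivity) (by positivity), ← Real.rpow_mul hn,
        mul_one_div_cancel hq0.ne', Real.rpow_one, NNRat.smul_def]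
      push_cast
      rfl)
  simp only [abs_of_nonneg (hf _ _), expect_apply] at h
  refine le_trans (le_of_eq ?_) h
  congr 1
  refine sum_congr rfl fun i _ => ?_
  rw [abs_of_nonneg (expect_nonneg fun a _ => hf i a)]

/-- Jensen's inequality for averages. -/
theorem expect_rpow_le {α : Type*} [Fintype α] [Nonempty α] {r : ℝ} (hr : 1 ≤ r)
    (f : α → ℝ) (hf : ∀ a, 0 ≤ f a) : (𝔼 a, f a) ^ r ≤ 𝔼 a, f a ^ r := by
  have h := Real.rpow_arith_mean_le_arith_mean_rpow univ (fun _ : α => ((Fintype.card α : ℝ))⁻¹) f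
    (fun _ _ => by positivity) (by simp) (fun a _ => hf a) hr
  rw [← mul_sum, ← mul_sum] at h
  rwa [Fintype.expect_eq_sum_div_card, Fintype.expect_eq_sum_div_card, div_eq_inv_mul,
    div_eq_inv_mul]

/-- Cotype `q` with `L₁` averages. -/
def CotypeL1 (F : Type*) [NormedAddCommGroup F] (q c : ℝ) : Prop :=
  ∀ (N : ℕ) (x : Fin N → F),
    (∑ j, ‖x j‖ ^ q) ^ (1 / q) ≤ c * 𝔼 ε : Fin N → ℤˣ, ‖∑ j, (ε j : ℤ) • x j‖

theorem HasCotype.exists_cotypeL1 {F : Type*} [NormedAddCommGroup F] [NormedSpace ℝ F] {q : ℝ}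
    (hF : HasCotype F q) : ∃ c, 0 ≤ c ∧ CotypeL1 F q c := by
  obtain ⟨K, hK, h⟩ := hF
  refine ⟨K * Real.sqrt 2, by positivity, fun N x => (h N x).trans ?_⟩
  have h1 := kahane_inequality x
  have h2 : (∑ ε : Fin N → ℤˣ, ‖∑ j, (ε j : ℤ) • x j‖ ^ 2) / 2 ^ N
      = 𝔼 ε : Fin N → ℤˣ, ‖∑ j, (ε j : ℤ) • x j‖ ^ 2 := by
    rw [Fintype.expect_eq_sum_div_card]
    simp [Fintype.card_units_int]
  rw [h2, mul_assoc]
  refine mul_le_mul_of_nonneg_left ?_ hK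
  refine (Real.sqrt_le_sqrt h1).trans (le_of_eq ?_)
  rw [Real.sqrt_mul (by norm_num), Real.sqrt_sq (expect_nonneg fun _ _ => norm_nonneg _)]

theorem sum_consEquiv {α M : Type*} [Fintype α] [AddCommMonoid M] {N : ℕ}
    (f : (Fin (N + 1) → α) → M) :
    ∑ j, f j = ∑ a, ∑ j : Fin N → α, f (Fin.cons a j : Fin (N + 1) → α) := by
  rw [← Fintype.sum_equiv (Fin.consEquiv fun _ : Fin (N + 1) => α)
    (fun x => f (Fin.cons x.1 x.2 : Fin (N + 1) → α)) f (fun _ => rfl), ← univ_product_univ,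
    sum_product]

/-- The cotype inequality for multi-indexed arrays and products of signs. -/
theorem CotypeL1.multi {F : Type*} [NormedAddCommGroup F] {q c : ℝ} (hq : 1 ≤ q) (hc : 0 ≤ c)
    (hF : CotypeL1 F q c) (m n : ℕ) (y : (Fin m → Fin n) → F) :
    (∑ j, ‖y j‖ ^ q) ^ (1 / q)
      ≤ c ^ m * 𝔼 ε : Fin m → Fin n → ℤˣ, ‖∑ j, (∏ k, (ε k (j k) : ℤ)) • y j‖ := by
  have hq0 : 0 < q := by linarith
  induction m with
  | zero =>
    simp [← Real.rpow_mul, hq0.ne']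
  | succ m ih =>
    set z : Fin n → (Fin m → Fin n → ℤˣ) → F := fun t ε =>
      ∑ j : Fin m → Fin n, (∏ k, (ε k (j k) : ℤ)) • y (Fin.cons t j : Fin (m + 1) → Fin n) with hz
    have h1 : ∀ t, ∑ j : Fin m → Fin n, ‖y (Fin.cons t j : Fin (m + 1) → Fin n)‖ ^ q
        ≤ (𝔼 ε, c ^ m * ‖z t ε‖) ^ q := by
      intro t
      have := ih fun j => y (Fin.cons t j : Fin (m + 1) → Fin n)
      rw [← mul_expect]
      rw [one_div] at this
      exact (Real.rpow_inv_le_iff_of_pos (sum_nonneg fun _ _ => by positivity)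
        (mul_nonneg (by positivity) (expect_nonneg fun _ _ => norm_nonneg _)) hq0).1 this
    calc (∑ j, ‖y j‖ ^ q) ^ (1 / q)
        ≤ (∑ t, (𝔼 ε, c ^ m * ‖z t ε‖) ^ q) ^ (1 / q) := by
          rw [sum_consEquiv]
          exact Real.rpow_le_rpow (sum_nonneg fun _ _ => sum_nonneg fun _ _ => by positivity)
            (sum_le_sum fun t _ => h1 t) (by positivity)
      _ ≤ 𝔼 ε, (∑ t, (c ^ m * ‖z t ε‖) ^ q) ^ (1 / q) :=
          Lq_expect_le hq _ fun _ _ => by positivity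
      _ = 𝔼 ε, c ^ m * (∑ t, ‖z t ε‖ ^ q) ^ (1 / q) := by
          refine expect_congr rfl fun ε _ => ?_
          simp_rw [Real.mul_rpow (pow_nonneg hc m) (norm_nonneg _), ← mul_sum]
          rw [Real.mul_rpow (by positivity) (sum_nonneg fun _ _ => by positivity),
            ← Real.rpow_mul (by positivity), mul_one_div_cancel hq0.ne', Real.rpow_one]
      _ ≤ 𝔼 ε, c ^ m * (c * 𝔼 σ : Fin n → ℤˣ, ‖∑ t, (σ t : ℤ) • z t ε‖) :=
          expect_le_expect fun ε _ =>
            mul_le_mul_of_nonneg_left (hF n fun t => z t ε) (by positivity)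
      _ = _ := by
          simp_rw [← mul_assoc, ← pow_succ]
          rw [← mul_expect, expect_comm, expect_consEquiv]
          congr 1
          refine expect_congr rfl fun σ _ => expect_congr rfl fun ε _ => ?_
          rw [sum_consEquiv]
          simp only [hz, smul_sum, smul_smul, Fin.prod_univ_succ, Fin.cons_zero, Fin.cons_succ]

/-- The base estimate: multilinear maps on products of `ℓ_∞^n`. -/
theorem base_estimate {𝕜 E F : Type*} [RCLike 𝕜] [NormedAddCommGroup E] [NormedSpace 𝕜 E]
    [NormedAddCommGroup F] [NormedSpace 𝕜 F] {q c r D M : ℝ} (hq : 1 ≤ q) (hc : 0 ≤ c)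
    (hF : CotypeL1 F q c) (hr : 1 ≤ r) (v : E →L[𝕜] F) (hD : D ∈ summingConstants r v)
    {m n : ℕ} (B : MultilinearMap 𝕜 (fun _ : Fin m => Fin n → 𝕜) E) (hM : 0 ≤ M)
    (hB : ∀ z : Fin m → Fin n → 𝕜, (∀ k j, ‖z k j‖ ≤ 1) → ‖B z‖ ≤ M) (i : Fin m) :
    ∑ t, (∑ j : Fin m → Fin n with j i = t,
        ‖v (B fun k => Pi.single (j k) (1 : 𝕜))‖ ^ q) ^ (r / q) ≤ (c ^ m * D * M) ^ r := by
  have hq0 : 0 < q := by linarith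
  have hr0 : 0 < r := by linarith
  obtain ⟨hD0, hD⟩ := hD
  set s : (Fin m → Fin n → ℤˣ) → Fin m → Fin n → 𝕜 := fun ε k t => ((ε k t : ℤ) : 𝕜) with hs
  have hs1 : ∀ ε k t, ‖s ε k t‖ = 1 := by
    intro ε k t
    rcases Int.units_eq_one_or (ε k t) with h | h <;> simp [hs, h]
  set w : (Fin m → Fin n → ℤˣ) → Fin n → E := fun ε t =>
    B (Function.update (s ε) i (Pi.single t (s ε i t))) with hw
  have hexp : ∀ ε t, ∑ j : Fin m → Fin n, (∏ k, (ε k (j k) : ℤ)) •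
      (if j i = t then v (B fun k => Pi.single (j k) (1 : 𝕜)) else 0) = v (w ε t) := by
    intro ε t
    have h1 : Function.update (s ε) i (Pi.single t (s ε i t)) = fun k => ∑ l : Fin n,
        ((if k = i → l = t then s ε k l else 0) • (Pi.single l (1 : 𝕜) : Fin n → 𝕜)) := by
      funext k x
      rcases eq_or_ne k i with rfl | hk
      · rw [Function.update_self, Finset.sum_apply]
        simp only [true_imp_iff, Pi.smul_apply, Pi.single_apply, smul_eq_mul, mul_ite, mul_one,
          mul_zero, sum_ite_eq, mem_univ, if_true]
        by_cases h : x = t <;> simp [h]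
      · simp [hk, Finset.sum_apply, Pi.single_apply]
    simp only [hw]
    rw [h1, MultilinearMap.map_sum, map_sum]
    refine sum_congr rfl fun j _ => ?_
    rw [MultilinearMap.map_smul_univ, map_smul]
    by_cases h : j i = t
    · have : ∀ k, (if k = i → j k = t then s ε k (j k) else 0) = s ε k (j k) := by
        intro k
        rw [if_pos]
        rintro rfl
        exact h
      rw [prod_congr rfl fun k _ => this k, if_pos h]
      simp only [hs]
      rw [← Int.cast_smul_eq_zsmul 𝕜]
      push_cast
      rfl
    · rw [if_neg h, smul_zero, prod_eq_zero (mem_univ i), zero_smul]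
      rw [if_neg]
      simpa using h
  have hrow : ∀ t, (∑ j : Fin m → Fin n with j i = t,
      ‖v (B fun k => Pi.single (j k) (1 : 𝕜))‖ ^ q) ^ (r / q)
        ≤ (c ^ m) ^ r * 𝔼 ε, ‖v (w ε t)‖ ^ r := by
    intro t
    have h1 := hF.multi hq hc m n
      (fun j => if j i = t then v (B fun k => Pi.single (j k) (1 : 𝕜)) else 0)
    simp only [hexp] at h1
    have h2 : ∑ j : Fin m → Fin n, ‖if j i = t then v (B fun k => Pi.single (j k) (1 : 𝕜))
          else 0‖ ^ q = ∑ j : Fin m → Fin n with j i = t,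
          ‖v (B fun k => Pi.single (j k) (1 : 𝕜))‖ ^ q := by
      rw [sum_filter]
      refine sum_congr rfl fun j _ => ?_
      split_ifs <;> simp [Real.zero_rpow hq0.ne']
    rw [h2] at h1
    have hnn : 0 ≤ ∑ j : Fin m → Fin n with j i = t,
          ‖v (B fun k => Pi.single (j k) (1 : 𝕜))‖ ^ q := sum_nonneg fun _ _ => by positivity
    have h3 := Real.rpow_le_rpow (by positivity) h1 hr0.le
    rw [← Real.rpow_mul hnn, one_div_mul_eq_div, Real.mul_rpow (by positivity)
      (expect_nonneg fun _ _ => norm_nonneg _)] at h3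
    exact h3.trans (mul_le_mul_of_nonneg_left
      (expect_rpow_le hr _ fun _ => norm_nonneg _) (by positivity))
  have hweak : ∀ ε, weakL1Norm 𝕜 (w ε) ≤ M := by
    intro ε
    have : Nonempty (Metric.closedBall (0 : StrongDual 𝕜 E) 1) := ⟨⟨0, by simp⟩⟩
    refine ciSup_le fun φ => ?_
    obtain ⟨φ, hφ⟩ := φ
    have hφ1 : ‖φ‖ ≤ 1 := by simpa using hφ
    choose a ha1 ha using fun t => RCLike.exists_norm_eq_mul_self (φ (w ε t))
    have h1 : (fun t => a t * s ε i t) = ∑ t, a t • (Pi.single t (s ε i t) : Fin n → 𝕜) := by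
      funext x
      simp [Finset.sum_apply, Pi.single_apply]
    have h2 : B (Function.update (s ε) i fun t => a t * s ε i t) = ∑ t, a t • w ε t := by
      rw [h1, MultilinearMap.map_update_sum]
      simp only [MultilinearMap.map_update_smul, hw]
    have h3 : ((∑ t, ‖φ (w ε t)‖ : ℝ) : 𝕜)
        = φ (B (Function.update (s ε) i fun t => a t * s ε i t)) := by
      rw [h2, map_sum]
      push_cast
      refine sum_congr rfl fun t _ => ?_
      rw [map_smul, smul_eq_mul]
      exact ha t
    have h4 : ‖B (Function.update (s ε) i fun t => a t * s ε i t)‖ ≤ M := by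
      refine hB _ fun k j => ?_
      rcases eq_or_ne k i with rfl | hk
      · simp [ha1, hs1]
      · simp [Function.update_of_ne hk, hs1]
    have h5 : ‖((∑ t, ‖φ (w ε t)‖ : ℝ) : 𝕜)‖ = ∑ t, ‖φ (w ε t)‖ :=
      RCLike.norm_of_nonneg (sum_nonneg fun _ _ => norm_nonneg _)
    calc ∑ t, ‖φ (w ε t)‖ = ‖φ (B (Function.update (s ε) i fun t => a t * s ε i t))‖ := by
          rw [← h3, h5]
      _ ≤ ‖φ‖ * ‖B (Function.update (s ε) i fun t => a t * s ε i t)‖ := φ.le_opNorm _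
      _ ≤ 1 * M := by gcongr
      _ = M := one_mul M
  have hcol : ∀ ε, ∑ t, ‖v (w ε t)‖ ^ r ≤ (D * M) ^ r := by
    intro ε
    have h1 := (hD n (w ε)).trans (mul_le_mul_of_nonneg_left (hweak ε) hD0)
    rw [one_div] at h1
    exact (Real.rpow_inv_le_iff_of_pos (sum_nonneg fun _ _ => by positivity)
      (by positivity) hr0).1 h1
  calc _ ≤ ∑ t, (c ^ m) ^ r * 𝔼 ε, ‖v (w ε t)‖ ^ r := sum_le_sum fun t _ => hrow t
    _ = (c ^ m) ^ r * 𝔼 ε, ∑ t, ‖v (w ε t)‖ ^ r := by rw [← mul_sum, expect_sum_comm]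
    _ ≤ (c ^ m) ^ r * (D * M) ^ r :=
        mul_le_mul_of_nonneg_left (expect_le univ_nonempty fun ε _ => hcol ε) (by positivity)
    _ = _ := by rw [mul_assoc (c ^ m), Real.mul_rpow (x := c ^ m) (by positivity) (by positivity)]

/-- Hölder's inequality with weights `a + b = 1`, endpoints included. -/
theorem sum_rpow_mul_rpow_le {ι : Type*} [Fintype ι] {f g : ι → ℝ} (hf : ∀ i, 0 ≤ f i)
    (hg : ∀ i, 0 ≤ g i) {a b : ℝ} (ha : 0 ≤ a) (hb : 0 ≤ b) (hab : a + b = 1) :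
    ∑ i, f i ^ a * g i ^ b ≤ (∑ i, f i) ^ a * (∑ i, g i) ^ b := by
  rcases ha.eq_or_lt with rfl | ha'
  · obtain rfl : b = 1 := by linarith
    simp
  rcases hb.eq_or_lt with rfl | hb'
  · obtain rfl : a = 1 := by linarith
    simp
  have h := Real.inner_le_Lp_mul_Lq_of_nonneg univ (f := fun i => f i ^ a) (g := fun i => g i ^ b)
    (p := a⁻¹) (q := b⁻¹) ⟨by simpa using hab, by positivity, by positivity⟩
    (fun i _ => Real.rpow_nonneg (hf i) _) (fun i _ => Real.rpow_nonneg (hg i) _)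
  simpa only [Real.rpow_rpow_inv (hf _) ha'.ne', Real.rpow_rpow_inv (hg _) hb'.ne', one_div,
    inv_inv] using h

/-- Duality between `ℓ_{1/θ}` and `ℓ_{1/(1-θ)}`. -/
theorem sum_rpow_le_of_forall_weight {ι : Type*} [Fintype ι] {c : ι → ℝ} (hc : ∀ k, 0 ≤ c k)
    {θ K : ℝ} (hθ1 : θ < 1) (hK : 0 ≤ K)
    (h : ∀ u : ι → ℝ, (∀ k, 0 ≤ u k) → ∑ k, u k ≤ 1 → ∑ k, c k * u k ^ θ ≤ K) :
    ∑ k, c k ^ (1 - θ)⁻¹ ≤ K ^ (1 - θ)⁻¹ := by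
  have h1 : 0 < 1 - θ := by linarith
  set s := (1 - θ)⁻¹ with hs
  have hs0 : 0 < s := inv_pos.2 h1
  set Z := ∑ k, c k ^ s with hZ
  have hZ0 : 0 ≤ Z := sum_nonneg fun k _ => Real.rpow_nonneg (hc k) _
  rcases hZ0.eq_or_lt with hZ1 | hZ1
  · rw [← hZ1]
    positivity
  have h2 := h (fun k => c k ^ s / Z) (fun k => div_nonneg (Real.rpow_nonneg (hc k) _) hZ0)
    (by rw [← sum_div, div_self hZ1.ne'])
  have hsθ : 1 + s * θ = s := by
    rw [hs]
    field_simp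
    ring
  have h3 : ∀ k, c k * (c k ^ s / Z) ^ θ = c k ^ s / Z ^ θ := by
    intro k
    rw [Real.div_rpow (Real.rpow_nonneg (hc k) _) hZ0, ← Real.rpow_mul (hc k), ← mul_div_assoc]
    congr 1
    nth_rewrite 1 [← Real.rpow_one (c k)]
    rw [← Real.rpow_add' (hc k) (by rw [hsθ]; exact hs0.ne'), hsθ]
  simp only [h3] at h2
  rw [← sum_div, ← hZ] at h2
  have h4 : Z / Z ^ θ = Z ^ (1 - θ) := by rw [Real.rpow_sub hZ1, Real.rpow_one]
  rw [h4] at h2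
  exact (Real.le_rpow_inv_iff_of_pos hZ0 hK h1).2 h2

/-- The exchange lemma: a weighted mixed bound on the rows and a mixed bound on the columns
give a mixed bound on the rows. -/
theorem rows_le_of_columns {X Y : Type*} [Fintype X] [Fintype Y] {D : X → Y → ℝ}
    (hD : ∀ x y, 0 ≤ D x y) {α α' τ M : ℝ} (hα : 0 < α) (hαα' : α ≤ α') (hα' : α' ≤ 1)
    (hτ : α'⁻¹ = α⁻¹ - τ) (hM : 0 ≤ M)
    (H1 : ∀ w : Y → ℝ, (∀ y, 0 ≤ w y) → ∑ y, w y ≤ 1 →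
      ∑ x, (∑ y, D x y * w y ^ τ) ^ α ≤ M ^ α)
    (H2 : ∑ y, (∑ x, D x y) ^ α' ≤ M ^ α') :
    ∑ x, (∑ y, D x y) ^ α' ≤ M ^ α' := by
  have hα'0 : 0 < α' := hα.trans_le hαα'
  rcases hα'.eq_or_lt with rfl | hα'1
  · simp only [Real.rpow_one] at H2 ⊢
    rwa [sum_comm]
  have hα1 : α < 1 := hαα'.trans_lt hα'1
  set S : X → ℝ := fun x => ∑ y, D x y with hS
  set T : Y → ℝ := fun y => ∑ x, D x y with hT
  set G : Y → ℝ := fun y => ∑ x, D x y * S x ^ (α - 1) with hG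
  have hS0 : ∀ x, 0 ≤ S x := fun x => sum_nonneg fun y _ => hD x y
  have hT0 : ∀ y, 0 ≤ T y := fun y => sum_nonneg fun x _ => hD x y
  have hDS0 : ∀ x y, 0 ≤ D x y * S x ^ (α - 1) := fun x y =>
    mul_nonneg (hD x y) (Real.rpow_nonneg (hS0 x) _)
  have hG0 : ∀ y, 0 ≤ G y := fun y => sum_nonneg fun x _ => hDS0 x y
  have hθ : (1 - τ * α) = α / α' := by
    rw [div_eq_mul_inv, hτ]
    field_simp
  have hGsum : ∑ y, G y ^ (α' / α) ≤ M ^ α' := by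
    have h := sum_rpow_le_of_forall_weight hG0 (θ := τ * α) (K := M ^ α)
      (by have : 0 < α / α' := by positivity
          linarith) (by positivity) (by
        intro w hw hw1
        refine le_trans ?_ (H1 w hw hw1)
        simp only [hG, sum_mul]
        rw [sum_comm]
        refine sum_le_sum fun x _ => ?_
        have h1 := sum_rpow_mul_rpow_le (f := D x) (g := fun y => D x y * w y ^ τ) (hD x)
          (fun y => mul_nonneg (hD x y) (Real.rpow_nonneg (hw y) _)) (a := 1 - α) (b := α)
          (by linarith) hα.le (by ring)
        have h2 : ∀ y, D x y ^ (1 - α) * (D x y * w y ^ τ) ^ α = D x y * w y ^ (τ * α) := by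
          intro y
          rw [Real.mul_rpow (hD x y) (Real.rpow_nonneg (hw y) _), ← mul_assoc,
            ← Real.rpow_add' (hD x y) (by norm_num), sub_add_cancel, Real.rpow_one,
            ← Real.rpow_mul (hw y)]
        simp only [h2] at h1
        have h3 : S x ^ (α - 1) * S x ^ (1 - α) ≤ 1 := by
          rcases (hS0 x).eq_or_lt with h | h
          · rw [← h, Real.zero_rpow (by linarith), zero_mul]
            exact zero_le_one
          · rw [← Real.rpow_add h]
            simp
        calc ∑ y, D x y * S x ^ (α - 1) * w y ^ (τ * α)
            = S x ^ (α - 1) * ∑ y, D x y * w y ^ (τ * α) := by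
              rw [mul_sum]
              exact sum_congr rfl fun y _ => by ring
          _ ≤ S x ^ (α - 1) * (S x ^ (1 - α) * (∑ y, D x y * w y ^ τ) ^ α) :=
              mul_le_mul_of_nonneg_left h1 (Real.rpow_nonneg (hS0 x) _)
          _ = (S x ^ (α - 1) * S x ^ (1 - α)) * (∑ y, D x y * w y ^ τ) ^ α := by ring
          _ ≤ 1 * (∑ y, D x y * w y ^ τ) ^ α :=
              mul_le_mul_of_nonneg_right h3 (Real.rpow_nonneg (sum_nonneg fun y _ =>
                mul_nonneg (hD x y) (Real.rpow_nonneg (hw y) _)) _)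
          _ = _ := one_mul _)
    rw [hθ, inv_div, ← Real.rpow_mul hM, mul_div_cancel₀ _ hα.ne'] at h
    exact h
  set η := (1 - α') / (1 - α) with hη
  have hη0 : 0 ≤ η := div_nonneg (by linarith) (by linarith)
  have hη1 : η ≤ 1 := (div_le_one (by linarith)).2 (by linarith)
  have hηα : (α - 1) * η = α' - 1 := by
    rw [hη]
    have : 1 - α ≠ 0 := by linarith
    field_simp
    ring
  have hrow : ∀ x, S x ^ α' = ∑ y, D x y * S x ^ (α' - 1) := by
    intro x
    rw [← sum_mul]
    change _ = S x * _
    nth_rewrite 2 [← Real.rpow_one (S x)]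
    rw [← Real.rpow_add' (hS0 x) (by linarith)]
    congr 1
    ring
  have hcol : ∀ y, ∑ x, D x y * S x ^ (α' - 1) ≤ T y ^ (1 - η) * G y ^ η := by
    intro y
    refine le_trans (le_of_eq ?_) (sum_rpow_mul_rpow_le (fun x => hD x y) (fun x => hDS0 x y)
      (a := 1 - η) (b := η) (by linarith) hη0 (by ring))
    refine sum_congr rfl fun x _ => ?_
    rw [Real.mul_rpow (hD x y) (Real.rpow_nonneg (hS0 x) _), ← mul_assoc,
      ← Real.rpow_add' (hD x y) (by norm_num), sub_add_cancel, Real.rpow_one,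
      ← Real.rpow_mul (hS0 x), hηα]
  have hsum : (1 - η) / α' + η * α / α' = 1 := by
    have : (1 - η) + η * α = α' := by linarith
    rw [← add_div, this, div_self hα'0.ne']
  calc ∑ x, S x ^ α' = ∑ y, ∑ x, D x y * S x ^ (α' - 1) := by
        simp only [hrow]
        exact sum_comm
    _ ≤ ∑ y, T y ^ (1 - η) * G y ^ η := sum_le_sum fun y _ => hcol y
    _ = ∑ y, (T y ^ α') ^ ((1 - η) / α') * (G y ^ (α' / α)) ^ (η * α / α') := by
        refine sum_congr rfl fun y _ => ?_
        rw [← Real.rpow_mul (hT0 y), ← Real.rpow_mul (hG0 y)]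
        congr 2 <;> field_simp
    _ ≤ (∑ y, T y ^ α') ^ ((1 - η) / α') * (∑ y, G y ^ (α' / α)) ^ (η * α / α') :=
        sum_rpow_mul_rpow_le (fun y => Real.rpow_nonneg (hT0 y) _)
          (fun y => Real.rpow_nonneg (hG0 y) _) (div_nonneg (by linarith) hα'0.le)
          (by positivity) hsum
    _ ≤ (M ^ α') ^ ((1 - η) / α') * (M ^ α') ^ (η * α / α') := by
        have e1 : 0 ≤ (1 - η) / α' := div_nonneg (by linarith) hα'0.le
        have e2 : 0 ≤ η * α / α' := by positivity
        have e3 : 0 ≤ ∑ y, G y ^ (α' / α) := sum_nonneg fun y _ => Real.rpow_nonneg (hG0 y) _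
        have e4 : 0 ≤ ∑ y, T y ^ α' := sum_nonneg fun y _ => Real.rpow_nonneg (hT0 y) _
        gcongr
    _ = M ^ α' := by
        rw [← Real.rpow_add' (by positivity) (by rw [hsum]; norm_num), hsum, Real.rpow_one]

section Slices

variable {κ ι : Type*}

/-- Families of nonnegative vectors of total mass at most one. -/
def IsWeight [Fintype ι] (u : κ → ι → ℝ) : Prop :=
  ∀ k, (∀ x, 0 ≤ u k x) ∧ ∑ x, u k x ≤ 1

theorem IsWeight.update [Fintype ι] [DecidableEq κ] {u : κ → ι → ℝ} (hu : IsWeight u) (k : κ) {w : ι → ℝ}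
    (hw : ∀ x, 0 ≤ w x) (hw1 : ∑ x, w x ≤ 1) : IsWeight (Function.update u k w) := by
  intro l
  rcases eq_or_ne l k with rfl | h
  · simpa using ⟨hw, hw1⟩
  · simpa [Function.update_of_ne h] using hu l

variable [Fintype κ] [DecidableEq κ]

theorem prod_compl_update {τ : κ → ℝ} {S : Finset κ} {k : κ} (hk : k ∉ S) (u : κ → ι → ℝ) (w : ι → ℝ) (j : κ → ι) :
    ∏ l ∈ Sᶜ, Function.update u k w l (j l) ^ τ l
      = w (j k) ^ τ k * ∏ l ∈ (insert k S)ᶜ, u l (j l) ^ τ l := by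
  rw [compl_insert, ← mul_prod_erase _ _ (mem_compl.2 hk), Function.update_self]
  congr 1
  exact prod_congr rfl fun l hl => by rw [Function.update_of_ne (ne_of_mem_erase hl)]

variable [Fintype ι]

theorem prod_compl_nonneg {u : κ → ι → ℝ} (hu : IsWeight u) (τ : κ → ℝ) (S : Finset κ)
    (j : κ → ι) : 0 ≤ ∏ k ∈ Sᶜ, u k (j k) ^ τ k :=
  prod_nonneg fun k _ => Real.rpow_nonneg ((hu k).1 _) _

variable [DecidableEq ι]

/-- The sum over a slice of an array, with weights `u k ^ τ k` in the coordinates `k ∉ S`. -/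
noncomputable def weightedSlice (d : (κ → ι) → ℝ) (τ : κ → ℝ) (S : Finset κ) (u : κ → ι → ℝ)
    (i : κ) (x : ι) : ℝ :=
  ∑ j : κ → ι with j i = x, d j * ∏ k ∈ Sᶜ, u k (j k) ^ τ k

/-- The weighted mixed estimate in direction `i`, the coordinates in `S` being unweighted. -/
def SliceBound (d : (κ → ι) → ℝ) (τ : κ → ℝ) (M : ℝ) (S : Finset κ) (i : κ) (α : ℝ) : Prop :=
  ∀ u : κ → ι → ℝ, IsWeight u → ∑ x, weightedSlice d τ S u i x ^ α ≤ M ^ α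

variable {d : (κ → ι) → ℝ} {τ : κ → ℝ} {M : ℝ} {S : Finset κ}

theorem weightedSlice_nonneg (hd : ∀ j, 0 ≤ d j) {u : κ → ι → ℝ} (hu : IsWeight u) (i : κ)
    (x : ι) : 0 ≤ weightedSlice d τ S u i x :=
  sum_nonneg fun j _ => mul_nonneg (hd j) (prod_compl_nonneg hu τ S j)

theorem SliceBound.insert_self (hd : ∀ j, 0 ≤ d j) (hM : 0 ≤ M) {k : κ} (hk : k ∉ S) {α α' : ℝ}
    (hα : 0 < α) (hα' : 0 < α') (hτ : α'⁻¹ = α⁻¹ - τ k) (h : SliceBound d τ M S k α) :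
    SliceBound d τ M (insert k S) k α' := by
  intro u hu
  have hθ : (1 - τ k * α) = α / α' := by
    rw [div_eq_mul_inv, hτ]
    field_simp
  have hW := fun x => weightedSlice_nonneg (τ := τ) (S := insert k S) hd hu k x
  have h1 := sum_rpow_le_of_forall_weight (c := fun x => weightedSlice d τ (insert k S) u k x ^ α)
    (fun x => Real.rpow_nonneg (hW x) _) (θ := τ k * α) (K := M ^ α)
    (by have : 0 < α / α' := by positivity
        linarith) (by positivity) (by
      intro w hw hw1
      refine le_trans (le_of_eq ?_) (h _ (hu.update k hw hw1))
      refine sum_congr rfl fun x _ => ?_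
      rw [Real.rpow_mul (hw x), ← Real.mul_rpow (hW x) (Real.rpow_nonneg (hw x) _)]
      congr 1
      rw [weightedSlice, weightedSlice, sum_mul]
      refine sum_congr rfl fun j hj => ?_
      rw [prod_compl_update hk, (mem_filter.1 hj).2]
      ring)
  rw [hθ, inv_div, ← Real.rpow_mul hM, mul_div_cancel₀ _ hα.ne'] at h1
  refine le_trans (le_of_eq (sum_congr rfl fun x _ => ?_)) h1
  rw [← Real.rpow_mul (hW x), mul_div_cancel₀ _ hα.ne']

theorem SliceBound.insert_of_ne (hd : ∀ j, 0 ≤ d j) (hM : 0 ≤ M) {i k : κ} (hk : k ∉ S)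
    {α α' : ℝ} (hα : 0 < α) (hαα' : α ≤ α') (hα' : α' ≤ 1)
    (hτ : α'⁻¹ = α⁻¹ - τ k) (h : SliceBound d τ M S i α)
    (hself : SliceBound d τ M (insert k S) k α') : SliceBound d τ M (insert k S) i α' := by
  intro u hu
  set e : (κ → ι) → ℝ := fun j => d j * ∏ l ∈ (insert k S)ᶜ, u l (j l) ^ τ l with he
  have he0 : ∀ j, 0 ≤ e j := fun j => mul_nonneg (hd j) (prod_compl_nonneg hu τ _ j)
  have hrow : ∀ x, weightedSlice d τ (insert k S) u i x
      = ∑ y, ∑ j : κ → ι with j i = x ∧ j k = y, e j := by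
    intro x
    rw [weightedSlice, ← sum_fiberwise _ (fun j : κ → ι => j k)]
    exact sum_congr rfl fun y _ => by rw [filter_filter]
  have hcol : ∀ y, weightedSlice d τ (insert k S) u k y
      = ∑ x, ∑ j : κ → ι with j i = x ∧ j k = y, e j := by
    intro y
    rw [weightedSlice, ← sum_fiberwise _ (fun j : κ → ι => j i)]
    refine sum_congr rfl fun x _ => ?_
    rw [filter_filter]
    simp only [and_comm, he]
  simp only [hrow]
  refine rows_le_of_columns (fun x y => sum_nonneg fun j _ => he0 j) hα hαα' hα' hτ hM ?_ ?_
  · intro w hw hw1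
    refine le_trans (le_of_eq ?_) (h _ (hu.update k hw hw1))
    refine sum_congr rfl fun x _ => ?_
    congr 1
    rw [weightedSlice, ← sum_fiberwise _ (fun j : κ → ι => j k)]
    refine sum_congr rfl fun y _ => ?_
    rw [filter_filter, sum_mul]
    refine sum_congr rfl fun j hj => ?_
    rw [prod_compl_update hk, (mem_filter.1 hj).2.2]
    simp only [he]
    ring
  · simpa only [hcol] using hself u hu

/-- All coordinates of `S` may be unweighted as long as the resulting exponent is at most one. -/
theorem SliceBound.of_empty (hd : ∀ j, 0 ≤ d j) (hM : 0 ≤ M) (hτ : ∀ k, 0 ≤ τ k) {a : ℝ}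
    (h : ∀ i, SliceBound d τ M ∅ i a⁻¹) (S : Finset κ) (hS : 1 ≤ a - ∑ k ∈ S, τ k) (i : κ) :
    SliceBound d τ M S i (a - ∑ k ∈ S, τ k)⁻¹ := by
  induction S using Finset.induction_on generalizing i with
  | empty => simpa using h i
  | insert k S hk ih =>
    rw [sum_insert hk] at hS ⊢
    have h1 : 1 ≤ a - ∑ k ∈ S, τ k := by linarith [hτ k]
    have hself : SliceBound d τ M (insert k S) k (a - (τ k + ∑ k ∈ S, τ k))⁻¹ :=
      (ih h1 k).insert_self hd hM hk (by positivity) (by positivity)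
        (by rw [inv_inv, inv_inv]; ring)
    rcases eq_or_ne i k with rfl | -
    · exact hself
    · exact (ih h1 i).insert_of_ne hd hM hk (by positivity)
        (inv_anti₀ (by linarith) (by linarith [hτ k])) (inv_le_one_of_one_le₀ hS)
        (by rw [inv_inv, inv_inv]; ring) hself

/-- The mixed estimate without weights. -/
theorem sum_slice_rpow_le (hd : ∀ j, 0 ≤ d j) (hM : 0 ≤ M) (hτ : ∀ k, 0 ≤ τ k) {a : ℝ}
    (h : ∀ i, SliceBound d τ M ∅ i a⁻¹) (i : κ) (hi : 1 ≤ a - ∑ k with k ≠ i, τ k)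
    (hall : 0 < a - ∑ k, τ k) :
    ∑ x, (∑ j : κ → ι with j i = x, d j) ^ (a - ∑ k, τ k)⁻¹ ≤ M ^ (a - ∑ k, τ k)⁻¹ := by
  have hsum : ∑ k, τ k = τ i + ∑ k with k ≠ i, τ k := by
    rw [filter_ne', add_sum_erase _ _ (mem_univ i)]
  have h1 := (SliceBound.of_empty hd hM hτ h _ hi i).insert_self hd hM (by simp)
    (inv_pos.2 (by linarith)) (inv_pos.2 hall) (by rw [inv_inv, inv_inv, hsum]; ring)
  have h2 : insert i (univ.filter fun k => k ≠ i) = univ := by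
    ext k
    simp [em]
  rw [h2] at h1
  simpa [weightedSlice] using h1 (fun _ _ => 0) fun k => by simp

end Slices

/-- Multiplication by a weight `u ^ (1 / p)` maps the unit ball of `ℓ_∞^n` into that of `ℓ_p^n`. -/
theorem norm_toLp_weight_mul_le {𝕜 : Type*} [RCLike 𝕜] {p : ℝ≥0∞} [Fact (1 ≤ p)] {n : ℕ}
    {u : Fin n → ℝ} (hu : ∀ x, 0 ≤ u x) (hu1 : ∑ x, u x ≤ 1) {z : Fin n → 𝕜}
    (hz : ∀ x, ‖z x‖ ≤ 1) :
    ‖(WithLp.toLp p fun x => ((u x ^ (p⁻¹).toReal : ℝ) : 𝕜) * z x : ellp 𝕜 p n)‖ ≤ 1 := by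
  have hp : 1 ≤ p := Fact.out
  rcases eq_or_ne p ⊤ with rfl | hp'
  · rw [PiLp.norm_eq_ciSup]
    exact Real.iSup_le (fun x => by simpa using hz x) zero_le_one
  · have hp0 : 0 < p.toReal := ENNReal.toReal_pos (by positivity) hp'
    rw [PiLp.norm_eq_sum hp0]
    refine Real.rpow_le_one (sum_nonneg fun _ _ => by positivity) (le_trans (sum_le_sum
      fun x _ => ?_) hu1) (by positivity)
    change ‖((u x ^ (p⁻¹).toReal : ℝ) : 𝕜) * z x‖ ^ p.toReal ≤ u x
    have h0 : 0 ≤ u x ^ (p⁻¹).toReal := Real.rpow_nonneg (hu x) _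
    rw [norm_mul, RCLike.norm_of_nonneg h0, Real.mul_rpow h0 (norm_nonneg _), ← Real.rpow_mul (hu x),
      ENNReal.toReal_inv, inv_mul_cancel₀ hp0.ne', Real.rpow_one]
    exact mul_le_of_le_one_right (hu x) (Real.rpow_le_one (norm_nonneg _) (hz x) hp0.le)

theorem norm_map_le_of_norm_le_one {𝕜 E : Type*} [RCLike 𝕜] [NormedAddCommGroup E]
    [NormedSpace 𝕜 E] {m n : ℕ} {p : Fin m → ℝ≥0∞} [∀ k, Fact (1 ≤ p k)]
    (A : ContinuousMultilinearMap 𝕜 (fun k : Fin m => ellp 𝕜 (p k) n) E)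
    (z : ∀ k, ellp 𝕜 (p k) n) (hz : ∀ k, ‖z k‖ ≤ 1) : ‖A z‖ ≤ ‖A‖ := by
  refine (A.le_opNorm z).trans (mul_le_of_le_one_right (norm_nonneg _) ?_)
  exact prod_le_one (fun _ _ => norm_nonneg _) fun k _ => hz k

/-- The weighted estimate with all coordinates weighted. -/
theorem sliceBound_empty {𝕜 E F : Type*} [RCLike 𝕜] [NormedAddCommGroup E] [NormedSpace 𝕜 E]
    [NormedAddCommGroup F] [NormedSpace 𝕜 F] {q c r D : ℝ} (hq : 1 ≤ q) (hc : 0 ≤ c)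
    (hF : CotypeL1 F q c) (hr : 1 ≤ r) (v : E →L[𝕜] F) (hD : D ∈ summingConstants r v)
    {m n : ℕ} (p : Fin m → ℝ≥0∞) [∀ k, Fact (1 ≤ p k)]
    (A : ContinuousMultilinearMap 𝕜 (fun k : Fin m => ellp 𝕜 (p k) n) E) (i : Fin m) :
    SliceBound (fun j : Fin m → Fin n => ‖v (A fun k => stdVec 𝕜 (p k) n (j k))‖ ^ q)
      (fun k => (p k)⁻¹.toReal * q) ((c ^ m * D * ‖A‖) ^ q) ∅ i (r / q) := by
  intro u hu
  have hq0 : 0 < q := by linarith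
  have hD0 : 0 ≤ D := hD.1
  let g : ∀ k, (Fin n → 𝕜) →ₗ[𝕜] ellp 𝕜 (p k) n := fun k =>
    (WithLp.linearEquiv (p k) 𝕜 (Fin n → 𝕜)).symm.toLinearMap.comp
      (LinearMap.mulLeft 𝕜 (fun x => ((u k x ^ ((p k)⁻¹).toReal : ℝ) : 𝕜)))
  have hg : ∀ k (z : Fin n → 𝕜), g k z
      = WithLp.toLp (p k) fun x => ((u k x ^ ((p k)⁻¹).toReal : ℝ) : 𝕜) * z x := fun _ _ => rfl
  have hgs : ∀ k x, g k (Pi.single x 1)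
      = ((u k x ^ ((p k)⁻¹).toReal : ℝ) : 𝕜) • stdVec 𝕜 (p k) n x := by
    intro k x
    rw [hg]
    ext y
    by_cases h : y = x
    · subst h
      simp [stdVec, RCLike.real_smul_eq_coe_mul]
    · simp [stdVec, h]
  have h := base_estimate hq hc hF hr v hD (A.toMultilinearMap.compLinearMap g) (norm_nonneg A)
    (fun z hz => norm_map_le_of_norm_le_one A _ fun k =>
      norm_toLp_weight_mul_le (hu k).1 (hu k).2 (hz k)) i
  rw [← Real.rpow_mul (by positivity), mul_div_cancel₀ _ hq0.ne']
  refine le_trans (le_of_eq ?_) h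
  refine sum_congr rfl fun x _ => ?_
  congr 1
  refine sum_congr rfl fun j _ => ?_
  have hnn : ∀ k, 0 ≤ u k (j k) ^ ((p k)⁻¹).toReal := fun k => Real.rpow_nonneg ((hu k).1 _) _
  have h1 : (A.toMultilinearMap.compLinearMap g) (fun k => Pi.single (j k) 1)
      = (∏ k, ((u k (j k) ^ ((p k)⁻¹).toReal : ℝ) : 𝕜)) • A fun k => stdVec 𝕜 (p k) n (j k) := by
    rw [MultilinearMap.compLinearMap_apply]
    simp only [hgs]
    exact MultilinearMap.map_smul_univ _ _ _
  rw [h1, map_smul, norm_smul, norm_prod, Real.mul_rpow (by positivity) (norm_nonneg _), mul_comm,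
    compl_empty, ← Real.finsetProd_rpow _ _ fun _ _ => norm_nonneg _]
  congr 1
  refine prod_congr rfl fun k _ => ?_
  rw [RCLike.norm_of_nonneg (hnn k), ← Real.rpow_mul ((hu k).1 _)]

theorem mainTheorem8 {𝕜 : Type*} [RCLike 𝕜] (m : ℕ) (hm : 2 ≤ m) (q : ℝ) (hq : 2 ≤ q)
    {F : Type*} [NormedAddCommGroup F] [NormedSpace 𝕜 F] [CompleteSpace F]
    (hF : HasCotype F q) :
    ∃ C : ℝ, ∀ (r : ℝ), 1 ≤ r → r ≤ q →
      ∀ (p : Fin m → ℝ≥0∞) [∀ k, Fact (1 ≤ p k)],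
      ∑ k, ((p k)⁻¹).toReal < 1 / r →
      (∀ i : Fin m, ∑ k with k ≠ i, ((p k)⁻¹).toReal ≤ 1 / r - 1 / q) →
      ∀ {E : Type*} [NormedAddCommGroup E] [NormedSpace 𝕜 E] [CompleteSpace E]
        (v : E →L[𝕜] F), IsAbsolutelySumming r v →
      ∀ (n : ℕ) (A : ContinuousMultilinearMap 𝕜 (fun k : Fin m => ellp 𝕜 (p k) n) E)
        (i : Fin m),
        mixedSum (fun j : Fin m → Fin n => v (A (fun k => stdVec 𝕜 (p k) n (j k))))
            i (lambdaExp p r) q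
          ≤ C * ‖A‖ * summingNorm r v := by
  let _ : NormedSpace ℝ F := NormedSpace.restrictScalars ℝ 𝕜 F
  obtain ⟨c, hc, hcot⟩ := hF.exists_cotypeL1
  refine ⟨c ^ m, ?_⟩
  intro r hr hrq p _ hsum hsum' E _ _ _ v hv n A i
  have hq0 : 0 < q := by linarith
  have hr0 : 0 < r := by linarith
  have hl : 0 < lambdaExp p r := inv_pos.2 (by linarith)
  have hexp : (q / r - ∑ k, ((p k)⁻¹).toReal * q)⁻¹ = lambdaExp p r / q := by
    have : q / r - ∑ k, ((p k)⁻¹).toReal * q = (1 / r - ∑ k, ((p k)⁻¹).toReal) * q := by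
      rw [← sum_mul]
      ring
    rw [this, mul_inv, lambdaExp, ← div_eq_mul_inv]
  have key : ∀ D ∈ summingConstants r v,
      mixedSum (fun j : Fin m → Fin n => v (A (fun k => stdVec 𝕜 (p k) n (j k))))
        i (lambdaExp p r) q ≤ c ^ m * ‖A‖ * D := by
    intro D hD
    have hD0 : 0 ≤ D := hD.1
    have h := sum_slice_rpow_le (a := q / r) (fun j => Real.rpow_nonneg (norm_nonneg _) q)
      (by positivity : 0 ≤ (c ^ m * D * ‖A‖) ^ q)
      (fun k => mul_nonneg ENNReal.toReal_nonneg hq0.le)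
      (fun i => by
        rw [inv_div]
        exact sliceBound_empty (by linarith) hc hcot hr v hD p A i) i
      (by
        rw [← sum_mul]
        have h1 := mul_le_mul_of_nonneg_right (hsum' i) hq0.le
        rw [sub_mul, one_div_mul_cancel hq0.ne', one_div_mul_eq_div] at h1
        linarith)
      (by
        rw [← sum_mul]
        have h1 := mul_lt_mul_of_pos_right hsum hq0
        rw [one_div_mul_eq_div] at h1
        linarith)
    rw [hexp, ← Real.rpow_mul (by positivity), mul_div_cancel₀ _ hq0.ne'] at h
    rw [mixedSum, one_div, mul_right_comm]
    exact (Real.rpow_inv_le_iff_of_pos (sum_nonneg fun _ _ => Real.rpow_nonneg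
      (sum_nonneg fun _ _ => by positivity) _) (by positivity) hl).2 h
  have hCA : 0 ≤ c ^ m * ‖A‖ := by positivity
  rcases hCA.eq_or_lt with h0 | h0
  · obtain ⟨D, hD⟩ := hv
    simpa [← h0] using key D hD
  · rw [← div_le_iff₀' h0]
    exact le_csInf hv fun D hD => (div_le_iff₀' h0).2 (key D hD)
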